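/- Let $\xi$ be a random variable with $\mathbb E\,\xi=0$ and $\mathbb E\,\xi^2=1$, and let $(\xi_{i,j})_{i,j\ge 1}$ and $(\xi_i)_{i\ge1}$ be (each) families of independent copies of $\xi$. For $d\in\mathbb N$ let $$X_i^{(d)}=\frac{(\xi_{i,1},\dots,\xi_{i,d})}{\sqrt d}\in\mathbb R^d,\qquad S_n^{(d)}=X_1^{(d)}+\dots+X_n^{(d)},$$ and let $\|\cdot\|$ be the Euclidean norm. Suppose that for some $\alpha\in(1,2)$ $$\frac{\xi_1^2+\dots+\xi_m^2-m}{m^{1/\alpha}L(m)}\ \xrightarrow{\ w\ }\ \zeta_\alpha\qquad(m\to\infty),$$ where $L$ is a slowly varying function (that is, $L$ is positive and measurable on some half-line $[a,\infty)$ and $L(cx)/L(x)\to1$ as $x\to\infty$ for every $c>0$) and $\zeta_\alpha$ is a zero-mean random variable with a (non-degenerate) spectrally positive $\alpha$-stable distribution (that is, its characteristic function is $t\mapsto\exp\{-\sigma^\alpha|t|^\alpha(1-i\,\mathrm{sign}(t)\tan(\pi\alpha/2))+ibt\}$ for some $\sigma>0$ and $b\in\mathbb R$). Let $n=n(d)$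 be a sequence of positive integers with $n(d)\to\infty$ as $d\to\infty$. (a) If for some $\delta>0$ we have $n>d^{\frac{2-\alpha}{2\alpha-2}+\delta}$ for all sufficiently large $d$, then $$\frac{\|S_n^{(d)}\|^2-n}{\sqrt{2n^2/d}}\ \xrightarrow{\ w\ }\ \mathrm N(0,1)\qquad(d\to\infty).$$ (b) If for some $\delta>0$ we have $n<d^{\frac{2-\alpha}{2\alpha-2}-\delta}$ for all sufficiently large $d$, then $$\frac{\|S_n^{(d)}\|^2-n}{d^{-1}(nd)^{1/\alpha}L(nd)}\ \xrightarrow{\ w\ }\ \zeta_\alpha\qquad(d\to\infty).$$ Here $\xrightarrow{w}$ denotes convergence in distribution. -/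

import Mathlib

open MeasureTheory ProbabilityTheory Filter Topology

noncomputable section

/-- A function `L`, positive and measurable on some half-line `[a, ∞)`, is slowly varying (at
infinity) if `L (c x) / L x → 1` as `x → ∞`, for every `c > 0`. The values of `L` outside the
half-line play no role. -/
structure IsSlowlyVarying (L : ℝ → ℝ) : Prop where
  measurable_pos : ∃ a : ℝ, Measurable (fun x : Set.Ici a => L x) ∧ ∀ x ∈ Set.Ici a, 0 < L x
  tendsto_ratio : ∀ c : ℝ, 0 < c → Tendsto (fun x : ℝ => L (c * x) / L x) atTop (𝓝 1)

/-- The (non-degenerate) spectrally positive stable laws of index `α ≠ 1` on the real line: the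
stable laws `S_α(σ, β, b)` with scale `σ > 0`, skewness `β = 1` and arbitrary location `b`,
given by their characteristic function
`exp (-σ^α |t|^α (1 - i sign(t) tan(π α / 2)) + i b t)`. -/
def IsSpectrallyPositiveStable (α : ℝ) (μ : Measure ℝ) : Prop :=
  IsProbabilityMeasure μ ∧ ∃ σ : ℝ, 0 < σ ∧ ∃ b : ℝ, ∀ t : ℝ,
    charFun μ t =
      Complex.exp (-((σ ^ α * |t| ^ α : ℝ) : ℂ) *
          (1 - Complex.I * ((Real.sign t * Real.tan (Real.pi * α / 2) : ℝ) : ℂ)) +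
        Complex.I * ((b * t : ℝ) : ℂ))

/-- The family `X`, defined on `(Ω, P)`, consists of independent copies of the random variable
`ξ`, defined on `(Ω₀, P₀)`. -/
structure IndependentCopies {ι Ω Ω₀ : Type*} [MeasurableSpace Ω] [MeasurableSpace Ω₀]
    (X : ι → Ω → ℝ) (P : Measure Ω) (ξ : Ω₀ → ℝ) (P₀ : Measure Ω₀) : Prop where
  indep : iIndepFun X P
  identDistrib : ∀ i, IdentDistrib (X i) ξ P P₀

/-- The increment `X_i^{(d)} = (ξ_{i,1}, …, ξ_{i,d}) / √d` of the `d`-dimensional random walk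
(all indices start from `0`). -/
def increment {Ω : Type*} (ξ : ℕ × ℕ → Ω → ℝ) (d i : ℕ) (ω : Ω) : EuclideanSpace ℝ (Fin d) :=
  WithLp.toLp 2 fun j : Fin d => ξ (i, (j : ℕ)) ω / √(d : ℝ)

/-- The position `S_n^{(d)}` of the `d`-dimensional random walk after `n` steps. -/
def walk {Ω : Type*} (ξ : ℕ × ℕ → Ω → ℝ) (d n : ℕ) (ω : Ω) : EuclideanSpace ℝ (Fin d) :=
  ∑ i ∈ Finset.range n, increment ξ d i ω

end

/-!
Expanding the square, `‖S_n‖² - n = d⁻¹ (A + B)`, where the diagonal part `A = ∑ (ξ_{i,j}² - 1)` is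
a centred sum of `n d` independent copies of `ξ²` and the off-diagonal part `B` sums the products
`ξ_{i,j} ξ_{k,j}`, `i ≠ k`. By hypothesis `A / ((n d)^{1/α} L(n d))` converges to `ζ`. The columns
`j` contribute to `B` independent and identically distributed terms; after division by `√2 n` the
law of such a term converges to that of `(Z² - 1) / √2`, with `Z` standard normal, and its variance
converges to that of the limit. The convergence of variances makes the squares uniformly
integrable, so the central limit theorem applies to the triangular array of the columns without
higher moments of `ξ`, and `B / (√2 n √d)` is asymptotically standard normal. The two normings are
balanced when `(n d)^{1/α} = n √d`, that is `n = d^{(2 - α) / (2 α - 2)}`; a factor `d^{±δ}` away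
from this, one part dominates, since `L` is negligible against powers.
-/

section SlowVariation

variable {E : Type*} [NormedAddCommGroup E] {f : ℝ → E}

theorem tendstoInMeasure_sub_of_tendsto_sub (hf : StronglyMeasurable f)
    (h : ∀ u : ℝ, Tendsto (fun x => f (x + u) - f x) atTop (𝓝 0)) (μ : Measure ℝ)
    [IsFiniteMeasure μ] :
    TendstoInMeasure μ (fun x w => f (x + w) - f x) atTop (fun _ => 0) := by
  refine fun ε hε => tendsto_of_seq_tendsto fun x hx => ?_
  have hmeas (k : ℕ) : AEStronglyMeasurable (fun w => f (x k + w) - f (x k)) μ :=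
    ((hf.comp_measurable (measurable_const_add _)).sub
      stronglyMeasurable_const).aestronglyMeasurable
  exact tendstoInMeasure_of_tendsto_ae hmeas (ae_of_all _ fun w => (h w).comp hx) ε hε

theorem eventually_volume_le_norm_sub_lt (hf : StronglyMeasurable f)
    (h : ∀ u : ℝ, Tendsto (fun x => f (x + u) - f x) atTop (𝓝 0)) (R : ℝ) {ε : ℝ} (hε : 0 < ε)
    {c : ENNReal} (hc : 0 < c) :
    ∀ᶠ x in atTop, volume ({w | ε ≤ ‖f (x + w) - f x‖} ∩ Set.Icc (-R) R) < c := by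
  have hlim := tendstoInMeasure_iff_norm.1 (tendstoInMeasure_sub_of_tendsto_sub hf h
    (volume.restrict (Set.Icc (-R) R))) ε hε
  filter_upwards [hlim.eventually_lt_const hc] with x hx
  simpa only [sub_zero, Measure.restrict_apply₀' measurableSet_Icc.nullMeasurableSet] using hx

/-- **Uniform convergence theorem** for slowly varying functions, in additive form. -/
theorem tendstoUniformlyOn_sub_of_tendsto_sub (hf : StronglyMeasurable f)
    (h : ∀ u : ℝ, Tendsto (fun x => f (x + u) - f x) atTop (𝓝 0)) {K : Set ℝ}
    (hK : Bornology.IsBounded K) :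
    TendstoUniformlyOn (fun x u => f (x + u) - f x) 0 atTop K := by
  obtain ⟨R, hR, hKR⟩ := hK.subset_closedBall_lt 0 0
  rw [Metric.tendstoUniformlyOn_iff]
  intro ε hε
  let bad (x : ℝ) : Set ℝ := {w | ε / 2 ≤ ‖f (x + w) - f x‖} ∩ Set.Icc (-(2 * R)) (2 * R)
  obtain ⟨X, hX⟩ : ∃ X, ∀ x ≥ X, volume (bad x) < ENNReal.ofReal R :=
    eventually_atTop.1
      (eventually_volume_le_norm_sub_lt hf h _ (half_pos hε) (ENNReal.ofReal_pos.2 hR))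
  filter_upwards [eventually_ge_atTop (X + R)] with x hx u hu
  obtain ⟨hu₁, hu₂⟩ : -R ≤ u ∧ u ≤ R := abs_le.1 (by simpa using hKR hu)
  -- The exceptional sets of the base points `x` and `x + u` are too small to cover `[-R, R]`.
  obtain ⟨v, ⟨hv₁, hv₂⟩, hv⟩ :
      ∃ v ∈ Set.Icc (-R) R, v ∉ ((u + ·) ⁻¹' bad x) ∪ bad (x + u) := by
    by_contra! hcover
    have hvol : volume (Set.Icc (-R) R) < ENNReal.ofReal R + ENNReal.ofReal R :=
      calc volume (Set.Icc (-R) R) ≤ volume ((u + ·) ⁻¹' bad x) + volume (bad (x + u)) :=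
            (measure_mono hcover).trans (measure_union_le _ _)
        _ = volume (bad x) + volume (bad (x + u)) := by rw [measure_preimage_add]
        _ < _ := ENNReal.add_lt_add (hX _ (by linarith)) (hX _ (by linarith))
    rw [Real.volume_Icc, ← ENNReal.ofReal_add hR.le hR.le, sub_neg_eq_add] at hvol
    exact hvol.false
  have hgood₁ : ‖f (x + u + v) - f x‖ < ε / 2 := by
    by_contra! hlarge
    refine hv (.inl ⟨?_, ?_, ?_⟩)
    · simpa only [Set.mem_ofPred_eq, add_assoc] using hlarge
    all_goals linarith
  have hgood₂ : ‖f (x + u + v) - f (x + u)‖ < ε / 2 := by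
    by_contra! hlarge
    exact hv (.inr ⟨hlarge, by linarith, by linarith⟩)
  calc dist 0 (f (x + u) - f x)
      = ‖(f (x + u + v) - f x) - (f (x + u + v) - f (x + u))‖ := by
        rw [dist_zero_left, sub_sub_sub_cancel_left]
    _ ≤ ‖f (x + u + v) - f x‖ + ‖f (x + u + v) - f (x + u)‖ := norm_sub_le _ _
    _ < ε := by linarith

theorem isLittleO_id_of_tendsto_sub (hf : StronglyMeasurable f)
    (h : ∀ u : ℝ, Tendsto (fun x => f (x + u) - f x) atTop (𝓝 0)) : f =o[atTop] (id : ℝ → ℝ) := by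
  have hfloor : Tendsto (fun x : ℝ => (⌊x⌋₊ : ℝ)) atTop atTop :=
    tendsto_natCast_atTop_atTop.comp tendsto_nat_floor_atTop
  have hfract : Tendsto (fun x : ℝ => f x - f ⌊x⌋₊) atTop (𝓝 0) := by
    have hunif := tendstoUniformlyOn_sub_of_tendsto_sub hf h (Metric.isBounded_Icc (0 : ℝ) 1)
    rw [Metric.tendstoUniformlyOn_iff] at hunif
    refine Metric.tendsto_nhds.2 fun ε hε => ?_
    filter_upwards [hfloor.eventually (hunif ε hε), eventually_ge_atTop 0] with x hx hx0
    have hmem : x - ⌊x⌋₊ ∈ Set.Icc (0 : ℝ) 1 :=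
      ⟨sub_nonneg.2 (Nat.floor_le hx0), by linarith [Nat.lt_floor_add_one x]⟩
    simpa [dist_comm] using hx _ hmem
  have hnat : (fun k : ℕ => f k) =o[atTop] fun k : ℕ => (k : ℝ) := by
    have hstep : Tendsto (fun k : ℕ => f (k + 1 : ℕ) - f k) atTop (𝓝 0) := by
      simpa [Function.comp_def] using (h 1).comp tendsto_natCast_atTop_atTop
    have hsum := Asymptotics.isLittleO_sum_range_of_tendsto_zero hstep
    simp only [Finset.sum_range_sub (fun k : ℕ => f k)] at hsum
    have hconst : (fun _ : ℕ => f (0 : ℕ)) =o[atTop] fun k : ℕ => (k : ℝ) :=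
      Asymptotics.isLittleO_const_left.2
        (.inr (tendsto_norm_atTop_atTop.comp tendsto_natCast_atTop_atTop))
    simpa using hsum.add hconst
  have hfloor_le : (fun x : ℝ => (⌊x⌋₊ : ℝ)) =O[atTop] (id : ℝ → ℝ) := by
    refine Asymptotics.IsBigO.of_bound 1 ?_
    filter_upwards [eventually_ge_atTop 0] with x hx
    simpa [abs_of_nonneg hx] using Nat.floor_le hx
  have hfract' : (fun x : ℝ => f x - f ⌊x⌋₊) =o[atTop] (id : ℝ → ℝ) :=
    ((Asymptotics.isLittleO_one_iff ℝ).2 hfract).trans_isBigO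
      (Asymptotics.isLittleO_const_id_atTop (1 : ℝ)).isBigO
  simpa using hfract'.add ((hnat.comp_tendsto tendsto_nat_floor_atTop).trans_isBigO hfloor_le)

end SlowVariation

namespace IsSlowlyVarying

variable {L : ℝ → ℝ}

theorem eventually_pos (hL : IsSlowlyVarying L) : ∀ᶠ x in atTop, 0 < L x := by
  obtain ⟨a, -, hpos⟩ := hL.measurable_pos
  filter_upwards [eventually_ge_atTop a] with x hx using hpos x hx

theorem exists_measurable_eventuallyEq (hL : IsSlowlyVarying L) :
    ∃ M : ℝ → ℝ, Measurable M ∧ M =ᶠ[atTop] L := by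
  obtain ⟨a, hmeas, -⟩ := hL.measurable_pos
  obtain ⟨M, hM, hML⟩ :=
    (MeasurableEmbedding.subtype_coe measurableSet_Ici).exists_measurable_extend hmeas fun _ => ⟨0⟩
  refine ⟨M, hM, ?_⟩
  filter_upwards [eventually_ge_atTop a] with x hx using congrFun hML ⟨x, hx⟩

theorem tendsto_log_mul_sub_log (hL : IsSlowlyVarying L) {c : ℝ} (hc : 0 < c) :
    Tendsto (fun x => Real.log (L (c * x)) - Real.log (L x)) atTop (𝓝 0) := by
  have hlog := (hL.tendsto_ratio c hc).log one_ne_zero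
  rw [Real.log_one] at hlog
  refine hlog.congr' ?_
  filter_upwards [hL.eventually_pos, (tendsto_id.const_mul_atTop hc).eventually hL.eventually_pos]
    with x hx hcx using Real.log_div hcx.ne' hx.ne'

theorem isLittleO_log (hL : IsSlowlyVarying L) :
    (fun x => Real.log (L x)) =o[atTop] Real.log := by
  obtain ⟨M, hM, hML⟩ := hL.exists_measurable_eventuallyEq
  have hslow (u : ℝ) : Tendsto (fun y => Real.log (M (Real.exp (y + u)))
      - Real.log (M (Real.exp y))) atTop (𝓝 0) := by
    refine ((hL.tendsto_log_mul_sub_log (Real.exp_pos u)).comp Real.tendsto_exp_atTop).congr' ?_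
    have hshift := Real.tendsto_exp_atTop.comp (tendsto_atTop_add_const_right atTop u tendsto_id)
    filter_upwards [hshift.eventually hML, Real.tendsto_exp_atTop.eventually hML] with y hyu hy
    simp only [Function.comp_apply, id_eq] at hyu ⊢
    rw [hyu, hy, Real.exp_add, mul_comm]
  have hadd := isLittleO_id_of_tendsto_sub
    (Real.measurable_log.comp (hM.comp Real.measurable_exp)).stronglyMeasurable hslow
  refine (hadd.comp_tendsto Real.tendsto_log_atTop).congr' ?_ .rfl
  filter_upwards [hML, eventually_gt_atTop 0] with x hx hx0
  simp only [Function.comp_apply, Real.exp_log hx0, hx]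

theorem isEquivalent_log_rpow_mul (hL : IsSlowlyVarying L) {c : ℝ} (hc : c ≠ 0) :
    Asymptotics.IsEquivalent atTop (fun x => Real.log (x ^ c * L x)) fun x => c * Real.log x := by
  have hlittle : (fun x => Real.log (L x)) =o[atTop] fun x => c * Real.log x :=
    hL.isLittleO_log.const_mul_right hc
  refine (Asymptotics.IsEquivalent.refl.add_isLittleO hlittle).congr_left ?_
  filter_upwards [hL.eventually_pos, eventually_gt_atTop 0] with x hLx hx
  simp only [Pi.add_apply, Real.log_mul (Real.rpow_pos_of_pos hx c).ne' hLx.ne', Real.log_rpow hx]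

theorem eventually_rpow_mul_pos (hL : IsSlowlyVarying L) (c : ℝ) :
    ∀ᶠ x in atTop, 0 < x ^ c * L x := by
  filter_upwards [hL.eventually_pos, eventually_gt_atTop 0] with x hLx hx
  exact mul_pos (Real.rpow_pos_of_pos hx c) hLx

theorem tendsto_rpow_mul_atTop (hL : IsSlowlyVarying L) {c : ℝ} (hc : 0 < c) :
    Tendsto (fun x => x ^ c * L x) atTop atTop := by
  have hlog := (hL.isEquivalent_log_rpow_mul hc.ne').symm.tendsto_atTop
    (Real.tendsto_log_atTop.const_mul_atTop hc)
  refine (Real.tendsto_exp_atTop.comp hlog).congr' ?_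
  filter_upwards [hL.eventually_rpow_mul_pos c] with x hx using Real.exp_log hx

theorem tendsto_rpow_mul_zero (hL : IsSlowlyVarying L) {c : ℝ} (hc : c < 0) :
    Tendsto (fun x => x ^ c * L x) atTop (𝓝 0) := by
  have hlog := (hL.isEquivalent_log_rpow_mul hc.ne).symm.tendsto_atBot
    (Real.tendsto_log_atTop.const_mul_atTop_of_neg hc)
  refine (Real.tendsto_exp_atBot.comp hlog).congr' ?_
  filter_upwards [hL.eventually_rpow_mul_pos c] with x hx using Real.exp_log hx

end IsSlowlyVarying

section ConvergenceInDistribution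

variable {ι κ E Ω Ω₁ Ω₂ : Type*} {mΩ : MeasurableSpace Ω} {mΩ₁ : MeasurableSpace Ω₁}
  {mΩ₂ : MeasurableSpace Ω₂} {P : Measure Ω} {P₁ : Measure Ω₁} {P₂ : Measure Ω₂}
  [IsProbabilityMeasure P] [IsProbabilityMeasure P₁] [IsProbabilityMeasure P₂]
  {mE : MeasurableSpace E} {l : Filter ι}

theorem tendstoInDistribution_comp_tendsto [TopologicalSpace E] [OpensMeasurableSpace E]
    {X : ι → Ω → E} {Z : Ω₁ → E} (hX : TendstoInDistribution X l Z (fun _ => P) P₁)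
    {l' : Filter κ} {k : κ → ι} (hk : Tendsto k l' l) :
    TendstoInDistribution (fun i => X (k i)) l' Z (fun _ => P) P₁ where
  forall_aemeasurable i := hX.forall_aemeasurable (k i)
  aemeasurable_limit := hX.aemeasurable_limit
  tendsto := hX.tendsto.comp hk

theorem tendstoInDistribution_of_forall_identDistrib [TopologicalSpace E] [OpensMeasurableSpace E]
    {X : ι → Ω → E} {Y : ι → Ω₂ → E} {Z : Ω₁ → E}
    (hX : TendstoInDistribution X l Z (fun _ => P) P₁)
    (hYX : ∀ i, IdentDistrib (Y i) (X i) P₂ P) :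
    TendstoInDistribution Y l Z (fun _ => P₂) P₁ where
  forall_aemeasurable i := (hYX i).aemeasurable_fst
  aemeasurable_limit := hX.aemeasurable_limit
  tendsto := hX.tendsto.congr fun i => Subtype.ext (hYX i).map_eq.symm

theorem tendstoInMeasure_const_of_tendstoInDistribution [PseudoEMetricSpace E]
    [OpensMeasurableSpace E] {X : ι → Ω → E} {a : E}
    (hX : TendstoInDistribution X l (fun _ : Ω₁ => a) (fun _ => P) P₁) :
    TendstoInMeasure P X l fun _ => a := by
  intro ε hε
  have hclosed : IsClosed {x : E | ε ≤ edist x a} := isClosed_le continuous_const (by fun_prop)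
  have hlimsup := ProbabilityMeasure.limsup_measure_closed_le_of_tendsto hX.tendsto hclosed
  simp only [ProbabilityMeasure.coe_mk] at hlimsup
  simp only [Measure.map_apply_of_aemeasurable (hX.forall_aemeasurable _) hclosed.measurableSet,
    Measure.map_apply measurable_const hclosed.measurableSet] at hlimsup
  refine tendsto_of_le_liminf_of_limsup_le zero_le (hlimsup.trans_eq ?_)
  simp [hε.ne']

variable [SeminormedAddCommGroup E] [NormedSpace ℝ E] [SecondCountableTopology E] [BorelSpace E]
  [l.IsCountablyGenerated] {X Y V : ι → Ω → E} {Z : Ω₁ → E} {W : Ω₂ → E} {c : ι → ℝ}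

theorem tendstoInMeasure_smul_zero_of_tendstoInDistribution
    (hY : TendstoInDistribution Y l W (fun _ => P) P₂) (hc : Tendsto c l (𝓝 0)) :
    TendstoInMeasure P (fun i ω => c i • Y i ω) l fun _ => 0 := by
  have hc' : TendstoInMeasure P (fun i _ => c i) l fun _ => (0 : ℝ) := by
    refine fun ε hε => tendsto_const_nhds.congr' ?_
    filter_upwards [hc.eventually (Metric.eball_mem_nhds 0 hε)] with i hi
    simp only [hi.not_ge, Set.ofPred_false, measure_empty]
  have hprod := hY.continuous_comp_prodMk_of_tendstoInMeasure_const
    (g := fun p : E × ℝ => p.2 • p.1) (by fun_prop) hc' fun _ => aemeasurable_const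
  simp only [zero_smul] at hprod
  exact tendstoInMeasure_const_of_tendstoInDistribution hprod

theorem tendstoInDistribution_of_eventually_eq_add_smul
    (hX : TendstoInDistribution X l Z (fun _ => P) P₁)
    (hY : TendstoInDistribution Y l W (fun _ => P) P₂) (hc : Tendsto c l (𝓝 0))
    (hV : ∀ i, AEMeasurable (V i) P) (hVXY : ∀ᶠ i in l, ∀ ω, V i ω = X i ω + c i • Y i ω) :
    TendstoInDistribution V l Z (fun _ => P) P₁ := by
  refine tendstoInDistribution_of_tendstoInMeasure_sub V Z hX ?_ hV
  refine (tendstoInMeasure_smul_zero_of_tendstoInDistribution hY hc).congr' ?_ .rfl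
  filter_upwards [hVXY] with i hi
  exact ae_of_all _ fun ω => by simp [hi ω]

end ConvergenceInDistribution

section CentralLimitTheorem

theorem norm_exp_mul_I_sub_taylor_two_le (y : ℝ) :
    ‖Complex.exp (y * Complex.I) - 1 - y * Complex.I + (y : ℂ) ^ 2 / 2‖
      ≤ 4 * (y ^ 2 * min |y| 1) := by
  have hnorm : ‖(y : ℂ) * Complex.I‖ = |y| := by simp
  rcases le_or_gt |y| 1 with hy | hy
  · have hexp := Complex.exp_bound (x := (y : ℂ) * Complex.I) (hnorm.trans_le hy) (n := 3)
      (by norm_num)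
    have hsum : ∑ m ∈ Finset.range 3, ((y : ℂ) * Complex.I) ^ m / (m.factorial : ℂ)
        = 1 + y * Complex.I - (y : ℂ) ^ 2 / 2 := by
      simp [Finset.sum_range_succ, Nat.factorial, mul_pow]
      ring
    rw [hsum, hnorm] at hexp
    calc ‖Complex.exp (y * Complex.I) - 1 - y * Complex.I + (y : ℂ) ^ 2 / 2‖
        = ‖Complex.exp (y * Complex.I) - (1 + y * Complex.I - (y : ℂ) ^ 2 / 2)‖ := by
          congr 1
          ring
      _ ≤ |y| ^ 3 * (2 / 9) := hexp.trans_eq (by norm_num [Nat.factorial])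
      _ ≤ 4 * (y ^ 2 * min |y| 1) := by
          rw [min_eq_left hy, ← sq_abs y, ← pow_succ]
          linarith [pow_nonneg (abs_nonneg y) 3]
  · calc ‖Complex.exp (y * Complex.I) - 1 - y * Complex.I + (y : ℂ) ^ 2 / 2‖
        ≤ ‖Complex.exp (y * Complex.I)‖ + ‖(1 : ℂ)‖ + ‖(y : ℂ) * Complex.I‖
            + ‖(y : ℂ) ^ 2 / 2‖ :=
          (norm_add_le _ _).trans <| add_le_add_left ((norm_sub_le _ _).trans <|
            add_le_add_left (norm_sub_le _ _) _) _
      _ = 1 + 1 + |y| + y ^ 2 / 2 := by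
          rw [Complex.norm_exp_ofReal_mul_I, hnorm]
          simp
      _ ≤ 4 * (y ^ 2 * min |y| 1) := by
          rw [min_eq_right hy.le]
          nlinarith [sq_abs y]

theorem integrable_sq_mul_min {μ : Measure ℝ} (hμ : MemLp id 2 μ) (s : ℝ) :
    Integrable (fun x => x ^ 2 * min |s * x| 1) μ := by
  refine hμ.integrable_sq.mono' (by fun_prop) (ae_of_all _ fun x => ?_)
  rw [Real.norm_of_nonneg (by positivity)]
  exact mul_le_of_le_one_right (sq_nonneg x) (min_le_right _ _)

theorem norm_charFun_sub_taylor_two_le {μ : Measure ℝ} [IsProbabilityMeasure μ]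
    (hμ : MemLp id 2 μ) (hmean : ∫ x, x ∂μ = 0) (s : ℝ) :
    ‖charFun μ s - 1 + (s : ℂ) ^ 2 / 2 * (∫ x, x ^ 2 ∂μ : ℝ)‖ ≤
      4 * (s ^ 2 * ∫ x, x ^ 2 * min |s * x| 1 ∂μ) := by
  have hexp : Integrable (fun x : ℝ => Complex.exp ((s * x : ℝ) * Complex.I)) μ :=
    Integrable.of_bound (by fun_prop) 1 (ae_of_all _ fun x =>
      (Complex.norm_exp_ofReal_mul_I _).le)
  have hlin : Integrable (fun x : ℝ => ((s * x : ℝ) : ℂ) * Complex.I) μ :=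
    ((hμ.integrable one_le_two).const_mul s).ofReal.mul_const _
  have hquad : Integrable (fun x : ℝ => ((s * x : ℝ) : ℂ) ^ 2 / 2) μ := by
    refine (((hμ.integrable_sq.const_mul (s ^ 2)).div_const 2).ofReal (𝕜 := ℂ)).congr
      (ae_of_all _ fun x => ?_)
    simp [mul_pow]
  have hlin_eq : ∫ x, ((s * x : ℝ) : ℂ) * Complex.I ∂μ = 0 := by
    rw [integral_mul_const, integral_complex_ofReal, integral_const_mul, hmean]
    simp
  have hquad_eq : ∫ x, ((s * x : ℝ) : ℂ) ^ 2 / 2 ∂μ = (s : ℂ) ^ 2 / 2 * (∫ x, x ^ 2 ∂μ : ℝ) := by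
    rw [← integral_complex_ofReal, ← integral_const_mul]
    congr with x
    push_cast
    ring
  have hsub₁ : Integrable (fun x : ℝ => Complex.exp ((s * x : ℝ) * Complex.I) - 1) μ :=
    hexp.sub (integrable_const _)
  have hsub₂ : Integrable (fun x : ℝ =>
      Complex.exp ((s * x : ℝ) * Complex.I) - 1 - ((s * x : ℝ) : ℂ) * Complex.I) μ :=
    hsub₁.sub hlin
  calc ‖charFun μ s - 1 + (s : ℂ) ^ 2 / 2 * (∫ x, x ^ 2 ∂μ : ℝ)‖
      = ‖∫ x, (Complex.exp ((s * x : ℝ) * Complex.I) - 1 - ((s * x : ℝ) : ℂ) * Complex.I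
          + ((s * x : ℝ) : ℂ) ^ 2 / 2) ∂μ‖ := by
        rw [integral_add hsub₂ hquad, integral_sub hsub₁ hlin,
          integral_sub hexp (integrable_const _), hlin_eq, hquad_eq, charFun_apply_real]
        simp
    _ ≤ ∫ x, 4 * ((s * x) ^ 2 * min |s * x| 1) ∂μ := by
        refine norm_integral_le_of_norm_le ?_ (ae_of_all _ fun x =>
          norm_exp_mul_I_sub_taylor_two_le (s * x))
        simpa only [mul_pow, mul_assoc] using ((integrable_sq_mul_min hμ s).const_mul _).const_mul 4
    _ = 4 * (s ^ 2 * ∫ x, x ^ 2 * min |s * x| 1 ∂μ) := by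
        simp only [mul_pow, mul_assoc, integral_const_mul]

theorem tendsto_integral_of_bounded_sub {ι E : Type*} [TopologicalSpace E] [MeasurableSpace E]
    [OpensMeasurableSpace E] {l : Filter ι} {μ : ι → ProbabilityMeasure E}
    {ν : ProbabilityMeasure E} (hμ : Tendsto μ l (𝓝 ν)) {f g : E → ℝ}
    (hfμ : ∀ i, Integrable f (μ i)) (hfν : Integrable f (ν : Measure E))
    (hf : Tendsto (fun i => ∫ x, f x ∂(μ i : Measure E)) l (𝓝 (∫ x, f x ∂(ν : Measure E))))
    (hcont : Continuous (f - g)) {C : ℝ} (hbound : ∀ x, |f x - g x| ≤ C) :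
    Tendsto (fun i => ∫ x, g x ∂(μ i : Measure E)) l (𝓝 (∫ x, g x ∂(ν : Measure E))) := by
  let φ : BoundedContinuousFunction E ℝ :=
    BoundedContinuousFunction.ofNormedAddCommGroup (f - g) hcont C hbound
  have hφ (ρ : ProbabilityMeasure E) (hfρ : Integrable f (ρ : Measure E)) :
      ∫ x, f x ∂(ρ : Measure E) - ∫ x, φ x ∂(ρ : Measure E) = ∫ x, g x ∂(ρ : Measure E) := by
    rw [← integral_sub hfρ (φ.integrable _)]
    exact integral_congr_ae (ae_of_all _ fun x => sub_sub_cancel (f x) (g x))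
  have hlim := hf.sub (ProbabilityMeasure.tendsto_iff_forall_integral_tendsto.1 hμ φ)
  simpa only [hφ _ (hfμ _), hφ ν hfν] using hlim

theorem tendsto_integral_sq_mul_min_nhds_zero {ν : Measure ℝ} (hν : MemLp id 2 ν) :
    Tendsto (fun s => ∫ x, x ^ 2 * min |s * x| 1 ∂ν) (𝓝 0) (𝓝 0) := by
  have hlim : Tendsto (fun s => ∫ x, x ^ 2 * min |s * x| 1 ∂ν) (𝓝 0) (𝓝 (∫ _, (0 : ℝ) ∂ν)) := by
    refine tendsto_integral_filter_of_dominated_convergence (fun x => x ^ 2)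
      (.of_forall fun s => by fun_prop) (.of_forall fun s => ae_of_all _ fun x => ?_)
      hν.integrable_sq (ae_of_all _ fun x => ?_)
    · rw [Real.norm_of_nonneg (by positivity)]
      exact mul_le_of_le_one_right (sq_nonneg x) (min_le_right _ _)
    · have hcont : Continuous fun s : ℝ => x ^ 2 * min |s * x| 1 := by fun_prop
      simpa using hcont.tendsto 0
  simpa using hlim

theorem tendsto_integral_sq_mul_min {ι : Type*} {l : Filter ι} {μ : ι → ProbabilityMeasure ℝ}
    {ν : ProbabilityMeasure ℝ} (hμ : Tendsto μ l (𝓝 ν)) (hμ2 : ∀ i, MemLp id 2 (μ i : Measure ℝ))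
    (hν2 : MemLp id 2 (ν : Measure ℝ))
    (hvar : Tendsto (fun i => ∫ x, x ^ 2 ∂(μ i : Measure ℝ)) l
      (𝓝 (∫ x, x ^ 2 ∂(ν : Measure ℝ)))) {s : ι → ℝ} (hs : Tendsto s l (𝓝 0)) :
    Tendsto (fun i => ∫ x, x ^ 2 * min |s i * x| 1 ∂(μ i : Measure ℝ)) l (𝓝 0) := by
  have hfixed {r : ℝ} (hr : 0 < r) :
      Tendsto (fun i => ∫ x, x ^ 2 * min |r * x| 1 ∂(μ i : Measure ℝ)) l
        (𝓝 (∫ x, x ^ 2 * min |r * x| 1 ∂(ν : Measure ℝ))) := by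
    refine tendsto_integral_of_bounded_sub hμ (fun i => (hμ2 i).integrable_sq) hν2.integrable_sq
      hvar (by fun_prop) (C := (r⁻¹) ^ 2) fun x => ?_
    rw [id_eq]
    rcases le_total 1 |r * x| with hx | hx
    · rw [min_eq_right hx, mul_one, sub_self, abs_zero]
      positivity
    · have hxr : |x| ≤ r⁻¹ := by
        rwa [abs_mul, abs_of_pos hr, mul_comm, ← le_div_iff₀ hr, one_div] at hx
      rw [min_eq_left hx, abs_of_nonneg (sub_nonneg.2 (mul_le_of_le_one_right (sq_nonneg x) hx))]
      calc x ^ 2 - x ^ 2 * |r * x| ≤ x ^ 2 := sub_le_self _ (by positivity)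
        _ ≤ r⁻¹ ^ 2 := sq_le_sq.2 (hxr.trans (le_abs_self _))
  refine tendsto_order.2 ⟨fun a ha => .of_forall fun i =>
    ha.trans_le (integral_nonneg fun x => by positivity), fun ε hε => ?_⟩
  obtain ⟨r, hrε, hr⟩ := (((tendsto_integral_sq_mul_min_nhds_zero hν2).mono_left
    nhdsWithin_le_nhds).eventually_lt_const hε |>.and (self_mem_nhdsWithin (s := Set.Ioi 0))).exists
  filter_upwards [(hfixed hr).eventually_lt_const hrε,
    hs.eventually (Metric.closedBall_mem_nhds 0 hr)] with i hi hsi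
  refine lt_of_le_of_lt (integral_mono (integrable_sq_mul_min (hμ2 i) _)
    (integrable_sq_mul_min (hμ2 i) _) fun x => ?_) hi
  rw [dist_zero_right, Real.norm_eq_abs] at hsi
  dsimp only
  rw [abs_mul, abs_mul, abs_of_pos hr]
  gcongr

variable {μ : ℕ → ProbabilityMeasure ℝ} {ν : ProbabilityMeasure ℝ}

theorem tendsto_nat_mul_charFun_inv_sqrt_sub_one (hμ : Tendsto μ atTop (𝓝 ν))
    (hμ2 : ∀ d, MemLp id 2 (μ d : Measure ℝ)) (hmean : ∀ d, ∫ x, x ∂(μ d : Measure ℝ) = 0)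
    (hν2 : MemLp id 2 (ν : Measure ℝ))
    (hvar : Tendsto (fun d => ∫ x, x ^ 2 ∂(μ d : Measure ℝ)) atTop
      (𝓝 (∫ x, x ^ 2 ∂(ν : Measure ℝ)))) (t : ℝ) :
    Tendsto (fun d : ℕ => (d : ℂ) * (charFun (μ d : Measure ℝ) ((√d)⁻¹ * t) - 1)) atTop
      (𝓝 (-((t : ℂ) ^ 2 / 2 * (∫ x, x ^ 2 ∂(ν : Measure ℝ) : ℝ)))) := by
  set s : ℕ → ℝ := fun d => (√d)⁻¹ * t
  have hs : Tendsto s atTop (𝓝 0) := by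
    have hinv : Tendsto (fun d : ℕ => (√(d : ℝ))⁻¹) atTop (𝓝 0) :=
      tendsto_inv_atTop_zero.comp (Real.tendsto_sqrt_atTop.comp tendsto_natCast_atTop_atTop)
    simpa using hinv.mul_const t
  have hds {d : ℕ} (hd : d ≠ 0) : (d : ℝ) * s d ^ 2 = t ^ 2 := by
    rw [mul_pow, inv_pow, Real.sq_sqrt d.cast_nonneg]
    field_simp
  have hremainder : Tendsto (fun d : ℕ => (d : ℂ) * (charFun (μ d : Measure ℝ) (s d) - 1
      + (s d : ℂ) ^ 2 / 2 * (∫ x, x ^ 2 ∂(μ d : Measure ℝ) : ℝ))) atTop (𝓝 0) := by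
    have htail := (tendsto_integral_sq_mul_min hμ hμ2 hν2 hvar hs).const_mul (4 * t ^ 2)
    rw [mul_zero] at htail
    refine squeeze_zero_norm' ?_ htail
    filter_upwards [eventually_ne_atTop 0] with d hd
    rw [norm_mul, Complex.norm_natCast, ← hds hd]
    exact (mul_le_mul_of_nonneg_left (norm_charFun_sub_taylor_two_le (hμ2 d) (hmean d) (s d))
      d.cast_nonneg).trans_eq (by ring)
  have hmain : Tendsto (fun d => (t : ℂ) ^ 2 / 2 * (∫ x, x ^ 2 ∂(μ d : Measure ℝ) : ℝ)) atTop
      (𝓝 ((t : ℂ) ^ 2 / 2 * (∫ x, x ^ 2 ∂(ν : Measure ℝ) : ℝ))) :=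
    ((Complex.continuous_ofReal.tendsto _).comp hvar).const_mul _
  rw [← zero_sub]
  refine (hremainder.sub hmain).congr' ?_
  filter_upwards [eventually_ne_atTop 0] with d hd
  have hdsC : (t : ℂ) ^ 2 = d * (s d : ℂ) ^ 2 := by exact_mod_cast (hds hd).symm
  rw [hdsC]
  ring

theorem tendsto_charFun_inv_sqrt_pow (hμ : Tendsto μ atTop (𝓝 ν))
    (hμ2 : ∀ d, MemLp id 2 (μ d : Measure ℝ)) (hmean : ∀ d, ∫ x, x ∂(μ d : Measure ℝ) = 0)
    (hν2 : MemLp id 2 (ν : Measure ℝ))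
    (hvar : Tendsto (fun d => ∫ x, x ^ 2 ∂(μ d : Measure ℝ)) atTop
      (𝓝 (∫ x, x ^ 2 ∂(ν : Measure ℝ)))) (t : ℝ) :
    Tendsto (fun d : ℕ => charFun (μ d : Measure ℝ) ((√d)⁻¹ * t) ^ d) atTop
      (𝓝 (Complex.exp (-((t : ℂ) ^ 2 / 2 * (∫ x, x ^ 2 ∂(ν : Measure ℝ) : ℝ))))) := by
  simpa only [add_sub_cancel] using Complex.tendsto_one_add_pow_exp_of_tendsto
    (tendsto_nat_mul_charFun_inv_sqrt_sub_one hμ hμ2 hmean hν2 hvar t)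

/-- The central limit theorem for triangular arrays whose rows are i.i.d.: the Lindeberg condition
is replaced by the convergence of the row laws together with their second moments. -/
theorem tendstoInDistribution_inv_sqrt_mul_sum_triangular {Ω : ℕ → Type*} {Ω' : Type*}
    [∀ d, MeasurableSpace (Ω d)] [MeasurableSpace Ω'] {P : ∀ d, Measure (Ω d)} {P' : Measure Ω'}
    [∀ d, IsProbabilityMeasure (P d)] [IsProbabilityMeasure P'] {X : ∀ d, ℕ → Ω d → ℝ}
    {Z : Ω' → ℝ} {v : NNReal} (hindep : ∀ d, iIndepFun (X d) (P d))
    (hident : ∀ d j, IdentDistrib (X d j) (X d 0) (P d) (P d))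
    (hX2 : ∀ d, MemLp (X d 0) 2 (P d)) (hmean : ∀ d, ∫ ω, X d 0 ω ∂P d = 0)
    (hXZ : TendstoInDistribution (fun d => X d 0) atTop Z P P') (hZ2 : MemLp Z 2 P')
    (hZvar : ∫ ω, Z ω ^ 2 ∂P' = v)
    (hvar : Tendsto (fun d => ∫ ω, X d 0 ω ^ 2 ∂P d) atTop (𝓝 v)) :
    TendstoInDistribution (fun (d : ℕ) ω => (√d)⁻¹ * ∑ j ∈ Finset.range d, X d j ω) atTop id P
      (gaussianReal 0 v) := by
  have hXm (d j : ℕ) : AEMeasurable (X d j) (P d) := (hident d j).aemeasurable_fst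
  have hZm : AEMeasurable Z P' := hXZ.aemeasurable_limit
  refine ⟨fun d => (Finset.aemeasurable_fun_sum _ fun j _ => hXm d j).const_mul _,
    aemeasurable_id, ProbabilityMeasure.tendsto_iff_tendsto_charFun.2 fun t => ?_⟩
  have hZvar' : ∫ x, x ^ 2 ∂(P'.map Z) = v := by rwa [integral_map hZm (by fun_prop)]
  have hlim := tendsto_charFun_inv_sqrt_pow hXZ.tendsto
    (fun d => (memLp_map_measure_iff (by fun_prop) (hXm d 0)).2 (hX2 d))
    (fun d => (integral_map (hXm d 0) (by fun_prop)).trans (hmean d))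
    ((memLp_map_measure_iff (by fun_prop) hZm).2 hZ2) ?_ t
  · simp only [ProbabilityMeasure.coe_mk, Measure.map_id, charFun_gaussianReal, hZvar'] at hlim ⊢
    convert! hlim using 2 with d
    · exact charFun_inv_sqrt_mul_sum (hindep d) (hident d)
    · congr 1
      simp
      ring
  · simp only [ProbabilityMeasure.coe_mk, hZvar', integral_map (hXm _ 0)
      (f := fun x : ℝ => x ^ 2) (by fun_prop)]
    exact hvar

end CentralLimitTheorem

section GaussianMoments

theorem hasDerivAt_gaussianPDFReal {v : NNReal} (hv : v ≠ 0) (x : ℝ) :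
    HasDerivAt (gaussianPDFReal 0 v) (-(x / v) * gaussianPDFReal 0 v x) x := by
  have hexponent : HasDerivAt (fun y : ℝ => -(y - 0) ^ 2 / (2 * v)) (-(x / v)) x := by
    convert! ((((hasDerivAt_id' x).sub_const 0).pow 2).neg.div_const (2 * (v : ℝ))) using 1
    field_simp
    ring
  exact (hexponent.exp.const_mul _).congr_deriv (by rw [gaussianPDFReal]; ring)

theorem integrable_pow_gaussianReal (v : NNReal) (n : ℕ) :
    Integrable (fun x : ℝ => x ^ n) (gaussianReal 0 v) :=
  (memLp_id_gaussianReal n).integrable_norm_pow'.mono' (by fun_prop) (by simp)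

theorem integral_pow_add_two_gaussianReal (v : NNReal) (n : ℕ) :
    ∫ x, x ^ (n + 2) ∂gaussianReal 0 v = v * (n + 1) * ∫ x, x ^ n ∂gaussianReal 0 v := by
  rcases eq_or_ne v 0 with rfl | hv
  · simp [gaussianReal_zero_var]
  have hint (k : ℕ) : Integrable (fun x : ℝ => x ^ k * gaussianPDFReal 0 v x) := by
    have h := integrable_pow_gaussianReal v k
    rw [gaussianReal_of_var_ne_zero _ hv, gaussianPDF_def, integrable_withDensity_iff
      (by fun_prop) (by simp)] at h
    simpa [gaussianPDFReal_nonneg] using h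
  have hv' : (v : ℝ) ≠ 0 := by exact_mod_cast hv
  have hparts : ∫ x : ℝ, x ^ (n + 1) * (-(x / v) * gaussianPDFReal 0 v x)
      = -∫ x : ℝ, (n + 1) * x ^ n * gaussianPDFReal 0 v x := by
    refine integral_mul_deriv_eq_deriv_mul_of_integrable
      (fun x _ => by simpa using hasDerivAt_pow (n + 1) x)
      (fun x _ => hasDerivAt_gaussianPDFReal hv x) ?_ ?_ (hint (n + 1))
    · refine ((hint (n + 2)).const_mul (-(v : ℝ)⁻¹)).congr (ae_of_all _ fun x => ?_)
      simp only [Pi.mul_apply]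
      ring
    · refine ((hint n).const_mul ((n : ℝ) + 1)).congr (ae_of_all _ fun x => ?_)
      simp only [Pi.mul_apply]
      ring
  calc ∫ x, x ^ (n + 2) ∂gaussianReal 0 v
      = -v * ∫ x : ℝ, x ^ (n + 1) * (-(x / v) * gaussianPDFReal 0 v x) := by
        rw [integral_gaussianReal_eq_integral_smul hv, ← integral_const_mul]
        congr with x
        rw [smul_eq_mul]
        field_simp
        ring
    _ = v * (n + 1) * ∫ x, x ^ n ∂gaussianReal 0 v := by
        rw [hparts, neg_mul_neg, mul_assoc, integral_gaussianReal_eq_integral_smul hv,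
          ← integral_const_mul ((n : ℝ) + 1)]
        congr with x
        rw [smul_eq_mul]
        ring

theorem integral_sq_gaussianReal (v : NNReal) : ∫ x, x ^ 2 ∂gaussianReal 0 v = v := by
  simpa using integral_pow_add_two_gaussianReal v 0

theorem integral_pow_four_gaussianReal (v : NNReal) :
    ∫ x, x ^ 4 ∂gaussianReal 0 v = 3 * v ^ 2 := by
  rw [integral_pow_add_two_gaussianReal v 2, integral_sq_gaussianReal]
  push_cast
  ring

theorem memLp_sq_sub_gaussianReal (v : NNReal) :
    MemLp (fun x : ℝ => x ^ 2 - v) 2 (gaussianReal 0 v) := by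
  refine MemLp.sub ((memLp_two_iff_integrable_sq (by fun_prop)).2 ?_) (memLp_const _)
  simpa only [← pow_mul] using integrable_pow_gaussianReal v 4

theorem integral_sq_sub_sq_gaussianReal (v : NNReal) :
    ∫ x, (x ^ 2 - v) ^ 2 ∂gaussianReal 0 v = 2 * v ^ 2 := by
  have hsq : MemLp (fun x : ℝ => x ^ 2) 2 (gaussianReal 0 v) :=
    (memLp_two_iff_integrable_sq (by fun_prop)).2 <| by
      simpa only [← pow_mul] using integrable_pow_gaussianReal v 4
  have hmean := integral_sq_gaussianReal v
  calc ∫ x, (x ^ 2 - v) ^ 2 ∂gaussianReal 0 v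
      = Var[fun x => x ^ 2; gaussianReal 0 v] := by
        rw [variance_eq_integral hsq.aemeasurable, hmean]
    _ = 2 * v ^ 2 := by
        rw [variance_eq_sub hsq, hmean]
        simp only [Pi.pow_apply, ← pow_mul, integral_pow_four_gaussianReal]
        ring

end GaussianMoments

theorem iIndepFun_pi_of_iIndepFun_prod {ι κ Ω E : Type*} [Countable ι] [Countable κ]
    [MeasurableSpace Ω] [MeasurableSpace E] {P : Measure Ω} {X : ι × κ → Ω → E}
    (hX : iIndepFun X P) (hm : ∀ p, AEMeasurable (X p) P) :
    iIndepFun (fun i ω k => X (i, k) ω) P := by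
  have := hX.isProbabilityMeasure
  have hprob (p : ι × κ) : IsProbabilityMeasure (P.map (X p)) :=
    Measure.isProbabilityMeasure_map (hm p)
  have hrow (i : ι) : AEMeasurable (fun ω k => X (i, k) ω) P :=
    aemeasurable_pi_lambda _ fun k => hm (i, k)
  rw [iIndepFun_iff_map_fun_eq_infinitePi_map₀' hrow]
  have hrowLaw (i : ι) : P.map (fun ω k => X (i, k) ω)
      = Measure.infinitePi fun k => P.map (X (i, k)) :=
    (hX.precomp (Prod.mk_right_injective i)).map_fun_eq_infinitePi_map₀' fun k => hm (i, k)
  simp only [hrowLaw]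
  rw [← Measure.infinitePi_map_curry (fun i k => P.map (X (i, k))),
    ← hX.map_fun_eq_infinitePi_map₀' hm,
    AEMeasurable.map_map_of_aemeasurable (by fun_prop) (aemeasurable_pi_lambda _ hm)]
  rfl

section OffDiagSum

variable {ι Ω : Type*} {mΩ : MeasurableSpace Ω} {P : Measure Ω} {X : ι → Ω → ℝ}

/-- The sum of `x i * x k` over all ordered pairs of distinct indices `i, k ∈ s`: twice the second
elementary symmetric polynomial of the `x i`. Applied to the coordinates of one column of the array
`ξ`, it collects the cross terms of the squared column sum. -/
def offDiagSum (s : Finset ι) (x : ι → ℝ) : ℝ :=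
  ∑ p ∈ s.offDiag, x p.1 * x p.2

theorem offDiagSum_eq_sq_sub (s : Finset ι) (x : ι → ℝ) :
    offDiagSum s x = (∑ i ∈ s, x i) ^ 2 - ∑ i ∈ s, x i ^ 2 := by
  classical
  rw [offDiagSum, eq_sub_iff_add_eq', sq, Finset.sum_mul_sum, ← Finset.sum_product',
    ← Finset.diag_union_offDiag, Finset.sum_union (Finset.disjoint_diag_offDiag s),
    Finset.sum_diag]
  simp only [sq]

theorem offDiagSum_cons {s : Finset ι} {a : ι} (ha : a ∉ s) (x : ι → ℝ) :
    offDiagSum (s.cons a ha) x = offDiagSum s x + 2 * ((∑ i ∈ s, x i) * x a) := by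
  simp only [offDiagSum_eq_sq_sub, Finset.sum_cons]
  ring

theorem measurable_offDiagSum (s : Finset ι) : Measurable (offDiagSum s) := by
  unfold offDiagSum
  fun_prop

theorem indepFun_sum_offDiagSum (hX : iIndepFun X P) (hm : ∀ i, AEMeasurable (X i) P)
    {s : Finset ι} {a : ι} (ha : a ∉ s) :
    IndepFun (fun ω => (∑ i ∈ s, X i ω, offDiagSum s fun i => X i ω)) (X a) P := by
  have heval : Measurable fun y : ({a} : Finset ι) → ℝ => y ⟨a, Finset.mem_singleton_self a⟩ :=
    measurable_pi_apply _
  have h := (hX.indepFun_finset₀ s {a} (Finset.disjoint_singleton_right.2 ha) hm).comp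
    (φ := fun y => (∑ i, y i, (∑ i, y i) ^ 2 - ∑ i, y i ^ 2)) (by fun_prop) heval
  convert! h using 2 with ω
  simp only [Function.comp_apply, offDiagSum_eq_sq_sub, ← Finset.sum_coe_sort s]

theorem memLp_two_mul_of_indepFun {X Y : Ω → ℝ} (hX : MemLp X 2 P) (hY : MemLp Y 2 P)
    (hXY : IndepFun X Y P) : MemLp (fun ω => X ω * Y ω) 2 P := by
  refine (memLp_two_iff_integrable_sq (hX.1.mul hY.1)).2 ?_
  have hsq : IndepFun (fun ω => X ω ^ 2) (fun ω => Y ω ^ 2) P :=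
    hXY.comp (φ := (· ^ 2)) (ψ := (· ^ 2)) (by fun_prop) (by fun_prop)
  simpa only [Pi.mul_apply, mul_pow] using! hsq.integrable_mul hX.integrable_sq hY.integrable_sq

theorem memLp_two_offDiagSum (hX : iIndepFun X P) (hL2 : ∀ i, MemLp (X i) 2 P) (s : Finset ι) :
    MemLp (fun ω => offDiagSum s fun i => X i ω) 2 P :=
  memLp_finsetSum _ fun _ hp => memLp_two_mul_of_indepFun (hL2 _) (hL2 _)
    (hX.indepFun (Finset.mem_offDiag.1 hp).2.2)

theorem integral_offDiagSum (hX : iIndepFun X P) (hL2 : ∀ i, MemLp (X i) 2 P)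
    (h0 : ∀ i, ∫ ω, X i ω ∂P = 0) (s : Finset ι) :
    ∫ ω, offDiagSum s (fun i => X i ω) ∂P = 0 := by
  unfold offDiagSum
  rw [integral_finsetSum _ fun p _ => (hL2 p.1).integrable_mul (hL2 p.2)]
  refine Finset.sum_eq_zero fun p hp => ?_
  rw [(hX.indepFun (Finset.mem_offDiag.1 hp).2.2).integral_fun_mul_eq_mul_integral
    (hL2 _).1 (hL2 _).1, h0, zero_mul]

theorem integral_sq_sum (hX : iIndepFun X P) (hL2 : ∀ i, MemLp (X i) 2 P)
    (h0 : ∀ i, ∫ ω, X i ω ∂P = 0) (s : Finset ι) :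
    ∫ ω, (∑ i ∈ s, X i ω) ^ 2 ∂P = ∑ i ∈ s, ∫ ω, X i ω ^ 2 ∂P := by
  have := hX.isProbabilityMeasure
  have hvar := IndepFun.variance_sum (s := s) (fun i _ => hL2 i)
    fun i _ j _ hij => hX.indepFun hij
  have hmean : ∫ ω, (∑ i ∈ s, X i) ω ∂P = 0 := by
    simp only [Finset.sum_apply]
    rw [integral_finsetSum _ fun i _ => (hL2 i).integrable one_le_two]
    exact Finset.sum_eq_zero fun i _ => h0 i
  rw [variance_of_integral_eq_zero (memLp_finsetSum' _ fun i _ => hL2 i).aemeasurable hmean]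
    at hvar
  simpa [fun i => variance_of_integral_eq_zero (hL2 i).aemeasurable (h0 i)] using hvar

theorem integral_sq_add_mul_mul_of_indepFun {U T X : Ω → ℝ} (hU : MemLp U 2 P) (hT : MemLp T 2 P)
    (hX : MemLp X 2 P) (h0 : ∫ ω, X ω ∂P = 0) (hind : IndepFun (fun ω => (T ω, U ω)) X P) (c : ℝ) :
    ∫ ω, (U ω + c * (T ω * X ω)) ^ 2 ∂P
      = ∫ ω, U ω ^ 2 ∂P + c ^ 2 * ((∫ ω, T ω ^ 2 ∂P) * ∫ ω, X ω ^ 2 ∂P) := by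
  have hTX : IndepFun T X P := hind.comp (ψ := id) measurable_fst measurable_id
  have hUTX : IndepFun (fun ω => U ω * T ω) X P :=
    hind.comp (φ := fun p : ℝ × ℝ => p.2 * p.1) (ψ := id) (by fun_prop) measurable_id
  have hTXsq : IndepFun (fun ω => T ω ^ 2) (fun ω => X ω ^ 2) P :=
    hTX.comp (φ := (· ^ 2)) (ψ := (· ^ 2)) (by fun_prop) (by fun_prop)
  have hcross : Integrable (fun ω => 2 * c * (U ω * (T ω * X ω))) P :=
    (hU.integrable_mul (memLp_two_mul_of_indepFun hT hX hTX)).const_mul _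
  have hsq : Integrable (fun ω => c ^ 2 * (T ω ^ 2 * X ω ^ 2)) P :=
    (hTXsq.integrable_mul hT.integrable_sq hX.integrable_sq).const_mul _
  have hcrossSq :
      Integrable (fun ω => 2 * c * (U ω * (T ω * X ω)) + c ^ 2 * (T ω ^ 2 * X ω ^ 2)) P :=
    hcross.add hsq
  have hcross0 : ∫ ω, U ω * (T ω * X ω) ∂P = 0 := by
    simp only [← mul_assoc]
    rw [hUTX.integral_fun_mul_eq_mul_integral (hU.1.mul hT.1) hX.1, h0, mul_zero]
  calc ∫ ω, (U ω + c * (T ω * X ω)) ^ 2 ∂P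
      = ∫ ω, U ω ^ 2 + (2 * c * (U ω * (T ω * X ω)) + c ^ 2 * (T ω ^ 2 * X ω ^ 2)) ∂P := by
        congr with ω
        ring
    _ = ∫ ω, U ω ^ 2 ∂P + (2 * c * ∫ ω, U ω * (T ω * X ω) ∂P
          + c ^ 2 * ∫ ω, T ω ^ 2 * X ω ^ 2 ∂P) := by
        rw [integral_add hU.integrable_sq hcrossSq, integral_add hcross hsq,
          integral_const_mul, integral_const_mul]
    _ = ∫ ω, U ω ^ 2 ∂P + c ^ 2 * ((∫ ω, T ω ^ 2 ∂P) * ∫ ω, X ω ^ 2 ∂P) := by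
        rw [hcross0, mul_zero, zero_add,
          hTXsq.integral_fun_mul_eq_mul_integral (hT.1.pow 2) (hX.1.pow 2)]

theorem integral_sq_offDiagSum (hX : iIndepFun X P) (hL2 : ∀ i, MemLp (X i) 2 P)
    (h0 : ∀ i, ∫ ω, X i ω ∂P = 0) (s : Finset ι) :
    ∫ ω, offDiagSum s (fun i => X i ω) ^ 2 ∂P = 2 * offDiagSum s fun i => ∫ ω, X i ω ^ 2 ∂P := by
  induction s using Finset.cons_induction with
  | empty => simp [offDiagSum]
  | cons a s ha ih =>
    simp only [offDiagSum_cons]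
    rw [integral_sq_add_mul_mul_of_indepFun (memLp_two_offDiagSum hX hL2 s)
      (memLp_finsetSum _ fun i _ => hL2 i) (hL2 a) (h0 a)
      (indepFun_sum_offDiagSum hX (fun i => (hL2 i).aemeasurable) ha), ih,
      integral_sq_sum hX hL2 h0]
    ring

theorem tendstoInDistribution_offDiagSum [IsProbabilityMeasure P] {X : ℕ → Ω → ℝ}
    (hX : iIndepFun X P) (hident : ∀ i, IdentDistrib (X i) (X 0) P P) (h0 : ∫ ω, X 0 ω ∂P = 0)
    (h1 : ∫ ω, X 0 ω ^ 2 ∂P = 1) :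
    TendstoInDistribution
      (fun (n : ℕ) ω => (√2 * n)⁻¹ * offDiagSum (Finset.range n) fun i => X i ω) atTop
      (fun x : ℝ => (√2)⁻¹ * (x ^ 2 - 1)) (fun _ => P) (gaussianReal 0 1) := by
  have hclt := tendstoInDistribution_inv_sqrt_mul_sum (HasLaw.id (μ := gaussianReal 0 1)) h0 h1
    hX hident
  have hmeas (n : ℕ) : AEMeasurable (fun ω => (∑ i ∈ Finset.range n, X i ω ^ 2) / n) P :=
    (Finset.aemeasurable_fun_sum _ fun i _ => (hident i).aemeasurable_fst.pow_const 2).div_const _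
  have hslln := strong_law_ae_real (fun i ω => X i ω ^ 2)
    (.of_integral_ne_zero (h1.trans_ne one_ne_zero))
    (fun i j hij => (hX.indepFun hij).comp (φ := (· ^ 2)) (ψ := (· ^ 2)) (by fun_prop)
      (by fun_prop))
    fun i => (hident i).comp (u := (· ^ 2)) (by fun_prop)
  rw [h1] at hslln
  have hlim := hclt.continuous_comp_prodMk_of_tendstoInMeasure_const
    (g := fun p : ℝ × ℝ => (√2)⁻¹ * (p.1 ^ 2 - p.2)) (by fun_prop)
    (tendstoInMeasure_of_tendsto_ae (fun n => (hmeas n).aestronglyMeasurable) hslln) hmeas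
  convert! hlim using 3 with n ω
  rw [offDiagSum_eq_sq_sub, mul_pow, inv_pow, Real.sq_sqrt (Nat.cast_nonneg n), mul_inv]
  ring

theorem tendsto_integral_sq_offDiagSum {X : ℕ → Ω → ℝ} (hX : iIndepFun X P)
    (hL2 : ∀ i, MemLp (X i) 2 P) (h0 : ∀ i, ∫ ω, X i ω ∂P = 0)
    (h1 : ∀ i, ∫ ω, X i ω ^ 2 ∂P = 1) :
    Tendsto (fun n : ℕ => ∫ ω, ((√2 * n)⁻¹ * offDiagSum (Finset.range n) fun i => X i ω) ^ 2 ∂P)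
      atTop (𝓝 1) := by
  have hlim : Tendsto (fun n : ℕ => 1 - (n : ℝ)⁻¹) atTop (𝓝 1) := by
    simpa using tendsto_inv_atTop_nhds_zero_nat.const_sub (1 : ℝ)
  refine hlim.congr' ?_
  filter_upwards [eventually_ne_atTop 0] with n hn
  simp only [mul_pow, inv_pow]
  rw [integral_const_mul, integral_sq_offDiagSum hX hL2 h0, offDiagSum_eq_sq_sub,
    Real.sq_sqrt zero_le_two]
  simp only [h1, one_pow, Finset.sum_const, Finset.card_range, nsmul_eq_mul, mul_one]
  field_simp

end OffDiagSum

section Norming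

variable {ι : Type*} {l : Filter ι} {D N : ι → ℝ} {L : ℝ → ℝ} {κ s : ℝ}

theorem sqrt_le_rpow_of_rpow_le {x y : ℝ} (hs : 0 < s) (hx : 0 ≤ x) (h : x ^ s ≤ y) :
    √x ≤ y ^ (2 * s)⁻¹ := by
  calc √x = (x ^ s) ^ (2 * s)⁻¹ := by
        rw [Real.sqrt_eq_rpow, ← Real.rpow_mul hx]
        congr 1
        field_simp
    _ ≤ y ^ (2 * s)⁻¹ := by gcongr

theorem rpow_le_sqrt_of_le_rpow {x y : ℝ} (hs : 0 < s) (hx : 0 ≤ x) (hy : 0 ≤ y) (h : y ≤ x ^ s) :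
    y ^ (2 * s)⁻¹ ≤ √x := by
  calc y ^ (2 * s)⁻¹ ≤ (x ^ s) ^ (2 * s)⁻¹ := by gcongr
    _ = √x := by
        rw [Real.sqrt_eq_rpow, ← Real.rpow_mul hx]
        congr 1
        field_simp

theorem IsSlowlyVarying.tendsto_sqrt_mul_rpow_mul_zero (hL : IsSlowlyVarying L) (hκ : 0 < κ)
    (hs : (2 * κ)⁻¹ < s) (hN : Tendsto N l atTop) (hD : ∀ᶠ i in l, 0 ≤ D i)
    (hDN : ∀ᶠ i in l, D i ^ s ≤ N i) :
    Tendsto (fun i => √(D i) * (N i ^ (-κ) * L (N i))) l (𝓝 0) := by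
  have hs0 : 0 < s := lt_trans (by positivity) hs
  have hexp : (2 * s)⁻¹ + -κ < 0 := by
    rw [inv_lt_iff_one_lt_mul₀ (by positivity)] at hs
    rw [← sub_eq_add_neg, sub_neg, inv_lt_iff_one_lt_mul₀ (by positivity)]
    linarith
  refine squeeze_zero' ?_ ?_ ((hL.tendsto_rpow_mul_zero hexp).comp hN)
  · filter_upwards [hN.eventually (hL.eventually_rpow_mul_pos (-κ))] with i hi
    positivity
  · filter_upwards [hN.eventually (hL.eventually_rpow_mul_pos (-κ)), hN.eventually_gt_atTop 0, hD,
      hDN] with i hi hNi hDi hDNi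
    calc √(D i) * (N i ^ (-κ) * L (N i))
        ≤ N i ^ (2 * s)⁻¹ * (N i ^ (-κ) * L (N i)) := by
          gcongr
          exact sqrt_le_rpow_of_rpow_le hs0 hDi hDNi
      _ = N i ^ ((2 * s)⁻¹ + -κ) * L (N i) := by rw [Real.rpow_add hNi, mul_assoc]

theorem IsSlowlyVarying.tendsto_sqrt_mul_rpow_mul_atTop (hL : IsSlowlyVarying L) (hs : 0 < s)
    (hsκ : s < (2 * κ)⁻¹) (hN : Tendsto N l atTop) (hD : ∀ᶠ i in l, 0 ≤ D i)
    (hND : ∀ᶠ i in l, N i ≤ D i ^ s) :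
    Tendsto (fun i => √(D i) * (N i ^ (-κ) * L (N i))) l atTop := by
  have hκ : 0 < 2 * κ := inv_pos.1 (hs.trans hsκ)
  have hexp : 0 < (2 * s)⁻¹ + -κ := by
    rw [lt_inv_comm₀ hs hκ] at hsκ
    rw [mul_inv]
    linarith
  refine tendsto_atTop_mono' l ?_ ((hL.tendsto_rpow_mul_atTop hexp).comp hN)
  filter_upwards [hN.eventually (hL.eventually_rpow_mul_pos (-κ)), hN.eventually_gt_atTop 0, hD,
    hND] with i hi hNi hDi hNDi
  calc N i ^ ((2 * s)⁻¹ + -κ) * L (N i)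
      = N i ^ (2 * s)⁻¹ * (N i ^ (-κ) * L (N i)) := by rw [Real.rpow_add hNi, mul_assoc]
    _ ≤ √(D i) * (N i ^ (-κ) * L (N i)) := by
        gcongr
        exact rpow_le_sqrt_of_le_rpow hs hDi hNi.le hNDi

/-- The order of magnitude of the diagonal part of `d * ‖walk ξ d n‖ ^ 2`, a centred sum of `n * d`
independent copies of `ξ ^ 2`. -/
noncomputable def stableNorming (α : ℝ) (L : ℝ → ℝ) (d n : ℕ) : ℝ :=
  ((n : ℝ) * d) ^ (1 / α) * L (n * d)

/-- The standard deviation of the off-diagonal part of `d * ‖walk ξ d n‖ ^ 2`, up to a factor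
`√(1 - 1 / n)`. -/
noncomputable def gaussianNorming (d n : ℕ) : ℝ :=
  √2 * n * √d

theorem stableNorming_div_gaussianNorming (α : ℝ) (L : ℝ → ℝ) {d n : ℕ} (hd : d ≠ 0) (hn : n ≠ 0) :
    stableNorming α L d n / gaussianNorming d n
      = (√2)⁻¹ * (√d * (((n : ℝ) * d) ^ (-(1 - 1 / α)) * L (n * d))) := by
  have hN : (0 : ℝ) < n * d := by positivity
  have hexp : ((n : ℝ) * d) ^ (1 / α) = n * (√d * √d) * ((n : ℝ) * d) ^ (-(1 - 1 / α)) := by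
    calc ((n : ℝ) * d) ^ (1 / α) = ((n : ℝ) * d) ^ (1 + -(1 - 1 / α)) := by ring_nf
      _ = n * (√d * √d) * ((n : ℝ) * d) ^ (-(1 - 1 / α)) := by
        rw [Real.rpow_add hN, Real.rpow_one, Real.mul_self_sqrt d.cast_nonneg]
  rw [stableNorming, gaussianNorming, hexp]
  field_simp

theorem eventually_stableNorming_pos (hL : IsSlowlyVarying L) (α : ℝ) {n : ℕ → ℕ}
    (hn : Tendsto n atTop atTop) : ∀ᶠ d in atTop, 0 < stableNorming α L d (n d) :=
  ((tendsto_natCast_atTop_atTop.comp hn).atTop_mul_atTop₀ tendsto_natCast_atTop_atTop).eventually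
    (hL.eventually_rpow_mul_pos (1 / α))

theorem critical_exponent_add_one {α : ℝ} (hα : 1 < α) :
    (2 - α) / (2 * α - 2) + 1 = (2 * (1 - 1 / α))⁻¹ := by
  have : α - 1 ≠ 0 := by linarith
  have : 2 * α - 2 ≠ 0 := by linarith
  field_simp
  ring

variable {α δ : ℝ} {n : ℕ → ℕ}

theorem tendsto_stableNorming_div_gaussianNorming_zero (hα : 1 < α) (hL : IsSlowlyVarying L)
    (hn : Tendsto n atTop atTop) (hδ : 0 < δ)
    (hnd : ∀ᶠ d : ℕ in atTop, (d : ℝ) ^ ((2 - α) / (2 * α - 2) + δ) < n d) :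
    Tendsto (fun d => stableNorming α L d (n d) / gaussianNorming d (n d)) atTop (𝓝 0) := by
  have hκ : 0 < 1 - 1 / α := sub_pos.2 ((div_lt_one (by positivity)).2 hα)
  have hN := (tendsto_natCast_atTop_atTop (R := ℝ).comp hn).atTop_mul_atTop₀
    (tendsto_natCast_atTop_atTop (R := ℝ))
  have hDN : ∀ᶠ d : ℕ in atTop, (d : ℝ) ^ ((2 - α) / (2 * α - 2) + δ + 1) ≤ n d * d := by
    filter_upwards [hnd, eventually_ne_atTop 0] with d hnd hd
    rw [Real.rpow_add_one (by positivity)]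
    gcongr
  have hlim := (hL.tendsto_sqrt_mul_rpow_mul_zero hκ (by linarith [critical_exponent_add_one hα])
    hN (.of_forall fun d => d.cast_nonneg) hDN).const_mul (√2)⁻¹
  rw [mul_zero] at hlim
  refine hlim.congr' ?_
  filter_upwards [eventually_ne_atTop 0, hn.eventually_ne_atTop 0] with d hd hnd
  exact (stableNorming_div_gaussianNorming α L hd hnd).symm

theorem tendsto_stableNorming_div_gaussianNorming_atTop (hα : 1 < α) (hL : IsSlowlyVarying L)
    (hn : Tendsto n atTop atTop) (hδ : 0 < δ)
    (hnd : ∀ᶠ d : ℕ in atTop, (n d : ℝ) < (d : ℝ) ^ ((2 - α) / (2 * α - 2) - δ)) :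
    Tendsto (fun d => stableNorming α L d (n d) / gaussianNorming d (n d)) atTop atTop := by
  have hκ : 0 < (2 * (1 - 1 / α))⁻¹ :=
    inv_pos.2 (mul_pos two_pos (sub_pos.2 ((div_lt_one (by positivity)).2 hα)))
  have hN := (tendsto_natCast_atTop_atTop (R := ℝ).comp hn).atTop_mul_atTop₀
    (tendsto_natCast_atTop_atTop (R := ℝ))
  -- The given exponent may be negative; since `d ≥ 1`, it can be raised to a positive one.
  have hs : 0 < max ((2 - α) / (2 * α - 2) - δ + 1) ((2 * (1 - 1 / α))⁻¹ / 2) :=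
    lt_max_of_lt_right (half_pos hκ)
  have hND : ∀ᶠ d : ℕ in atTop, (n d : ℝ) * d
      ≤ (d : ℝ) ^ max ((2 - α) / (2 * α - 2) - δ + 1) ((2 * (1 - 1 / α))⁻¹ / 2) := by
    filter_upwards [hnd, eventually_ge_atTop 1] with d hnd hd
    have hd1 : (1 : ℝ) ≤ d := by exact_mod_cast hd
    calc (n d : ℝ) * d ≤ (d : ℝ) ^ ((2 - α) / (2 * α - 2) - δ) * d := by gcongr
      _ = (d : ℝ) ^ ((2 - α) / (2 * α - 2) - δ + 1) := (Real.rpow_add_one (by positivity) _).symm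
      _ ≤ _ := Real.rpow_le_rpow_of_exponent_le hd1 (le_max_left _ _)
  have hlim := (hL.tendsto_sqrt_mul_rpow_mul_atTop hs
    (max_lt (by linarith [critical_exponent_add_one hα]) (half_lt_self hκ)) hN
    (.of_forall fun d => d.cast_nonneg) hND).const_mul_atTop (inv_pos.2 (Real.sqrt_pos.2 two_pos))
  refine hlim.congr' ?_
  filter_upwards [eventually_ne_atTop 0, hn.eventually_ne_atTop 0] with d hd hnd
  exact (stableNorming_div_gaussianNorming α L hd hnd).symm

end Norming

section Walk

variable {Ω₀ Ω₁ Ω Ω' : Type*} {mΩ₀ : MeasurableSpace Ω₀} {mΩ₁ : MeasurableSpace Ω₁}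
  {mΩ : MeasurableSpace Ω} {mΩ' : MeasurableSpace Ω'} {P₀ : Measure Ω₀} {P₁ : Measure Ω₁}
  {P : Measure Ω} {P' : Measure Ω'}
  {ξ₀ : Ω₀ → ℝ} {ξ : ℕ × ℕ → Ω → ℝ}

/-- The contribution of the squares `ξ (i, j) ^ 2` to `d * (‖walk ξ d n‖ ^ 2 - n)`. -/
def diagPart (ξ : ℕ × ℕ → Ω → ℝ) (d n : ℕ) (ω : Ω) : ℝ :=
  ∑ j ∈ Finset.range d, ∑ i ∈ Finset.range n, ξ (i, j) ω ^ 2 - n * d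

/-- The contribution of the products `ξ (i, j) * ξ (k, j)`, `i ≠ k`, to
`d * (‖walk ξ d n‖ ^ 2 - n)`. -/
def offDiagPart (ξ : ℕ × ℕ → Ω → ℝ) (d n : ℕ) (ω : Ω) : ℝ :=
  ∑ j ∈ Finset.range d, offDiagSum (Finset.range n) fun i => ξ (i, j) ω

theorem norm_walk_sq (ξ : ℕ × ℕ → Ω → ℝ) (d n : ℕ) (ω : Ω) :
    ‖walk ξ d n ω‖ ^ 2
      = (d : ℝ)⁻¹ * ∑ j ∈ Finset.range d, (∑ i ∈ Finset.range n, ξ (i, j) ω) ^ 2 := by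
  rw [EuclideanSpace.real_norm_sq_eq, Finset.mul_sum, Finset.sum_range]
  refine Finset.sum_congr rfl fun j _ => ?_
  simp only [walk, increment, WithLp.ofLp_sum, Finset.sum_apply]
  rw [← Finset.sum_div, div_pow, Real.sq_sqrt d.cast_nonneg, div_eq_inv_mul]

theorem norm_walk_sq_sub (ξ : ℕ × ℕ → Ω → ℝ) {d : ℕ} (hd : d ≠ 0) (n : ℕ) (ω : Ω) :
    ‖walk ξ d n ω‖ ^ 2 - n = (d : ℝ)⁻¹ * (diagPart ξ d n ω + offDiagPart ξ d n ω) := by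
  rw [norm_walk_sq]
  simp only [diagPart, offDiagPart, offDiagSum_eq_sq_sub, Finset.sum_sub_distrib]
  field_simp
  ring

theorem aemeasurable_norm_walk_sq_sub (hξ : ∀ p, AEMeasurable (ξ p) P) (d n : ℕ) :
    AEMeasurable (fun ω => ‖walk ξ d n ω‖ ^ 2 - n) P := by
  simp only [norm_walk_sq]
  fun_prop

theorem norm_walk_sq_sub_div_sqrt (ξ : ℕ × ℕ → Ω → ℝ) {d n : ℕ} (hd : d ≠ 0) (ω : Ω) {b : ℝ}
    (hb : b ≠ 0) :
    (‖walk ξ d n ω‖ ^ 2 - n) / √(2 * n ^ 2 / d)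
      = offDiagPart ξ d n ω / gaussianNorming d n
        + (b / gaussianNorming d n) • (diagPart ξ d n ω / b) := by
  have hnorming : (d : ℝ) * √(2 * n ^ 2 / d) = gaussianNorming d n := by
    rw [gaussianNorming, Real.sqrt_div (by positivity), Real.sqrt_mul zero_le_two,
      Real.sqrt_sq n.cast_nonneg, mul_div_left_comm, Real.div_sqrt]
  rw [norm_walk_sq_sub ξ hd, ← hnorming, smul_eq_mul]
  field_simp
  ring

theorem norm_walk_sq_sub_div_stable (ξ : ℕ × ℕ → Ω → ℝ) {d n : ℕ} (hd : d ≠ 0) (hn : n ≠ 0)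
    (ω : Ω) (α : ℝ) (L : ℝ → ℝ) :
    (‖walk ξ d n ω‖ ^ 2 - n) / ((d : ℝ)⁻¹ * ((n : ℝ) * d) ^ (1 / α) * L (n * d))
      = diagPart ξ d n ω / stableNorming α L d n
        + (stableNorming α L d n / gaussianNorming d n)⁻¹ •
          (offDiagPart ξ d n ω / gaussianNorming d n) := by
  have hg : gaussianNorming d n ≠ 0 := by
    rw [gaussianNorming]
    positivity
  rw [norm_walk_sq_sub ξ hd, mul_assoc, ← stableNorming, smul_eq_mul]
  field_simp

theorem IndependentCopies.identDistrib_sum_sq {η : ℕ → Ω₁ → ℝ} (hξ : IndependentCopies ξ P ξ₀ P₀)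
    (hη : IndependentCopies η P₁ ξ₀ P₀) (d n : ℕ) :
    IdentDistrib (fun ω => ∑ j ∈ Finset.range d, ∑ i ∈ Finset.range n, ξ (i, j) ω ^ 2)
      (fun ω => ∑ k ∈ Finset.range (n * d), η k ω ^ 2) P P₁ := by
  let e : Fin (n * d) ≃ Fin n × Fin d := finProdFinEquiv.symm
  let g (k : Fin (n * d)) : ℕ × ℕ := ((e k).1, (e k).2)
  have hg : Function.Injective g :=
    (Fin.val_injective.prodMap Fin.val_injective).comp e.injective
  have h := IdentDistrib.pi (X := fun k => ξ (g k)) (Y := fun k : Fin (n * d) => η k)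
    (fun k => (hξ.identDistrib _).trans (hη.identDistrib _).symm) (hξ.indep.precomp hg)
    (hη.indep.precomp Fin.val_injective)
  convert! h.comp (u := fun x : Fin (n * d) → ℝ => ∑ k, x k ^ 2) (by fun_prop) using 2 with ω ω
  · simp only [Function.comp_apply, g]
    rw [e.sum_comp (fun p => ξ (p.1, p.2) ω ^ 2), Fintype.sum_prod_type, Finset.sum_comm]
    simp only [Finset.sum_range]
  · simp only [Function.comp_apply, Finset.sum_range]

theorem IndependentCopies.iIndepFun_offDiagSum_column (hξ : IndependentCopies ξ P ξ₀ P₀) (n : ℕ) :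
    iIndepFun (fun j ω => offDiagSum (Finset.range n) fun i => ξ (i, j) ω) P := by
  have hcolumns := iIndepFun_pi_of_iIndepFun_prod (X := fun p : ℕ × ℕ => ξ p.swap)
    (hξ.indep.precomp Prod.swap_injective) fun p => (hξ.identDistrib p.swap).aemeasurable_fst
  exact hcolumns.comp (fun _ => offDiagSum (Finset.range n)) fun _ => measurable_offDiagSum _

theorem IndependentCopies.identDistrib_offDiagSum_column (hξ : IndependentCopies ξ P ξ₀ P₀)
    (n j k : ℕ) :
    IdentDistrib (fun ω => offDiagSum (Finset.range n) fun i => ξ (i, j) ω)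
      (fun ω => offDiagSum (Finset.range n) fun i => ξ (i, k) ω) P P :=
  (IdentDistrib.pi (X := fun i => ξ (i, j)) (Y := fun i => ξ (i, k))
    (fun _ => (hξ.identDistrib _).trans (hξ.identDistrib _).symm)
    (hξ.indep.precomp (Prod.mk_left_injective j))
    (hξ.indep.precomp (Prod.mk_left_injective k))).comp (measurable_offDiagSum _)

variable [IsProbabilityMeasure P]

theorem IndependentCopies.tendstoInDistribution_diagPart [IsProbabilityMeasure P₁]
    [IsProbabilityMeasure P'] {η : ℕ → Ω₁ → ℝ} {ζ : Ω' → ℝ} (hξ : IndependentCopies ξ P ξ₀ P₀)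
    (hη : IndependentCopies η P₁ ξ₀ P₀) {α : ℝ} {L : ℝ → ℝ}
    (hattr : TendstoInDistribution
      (fun (m : ℕ) ω => ((∑ k ∈ Finset.range m, η k ω ^ 2) - (m : ℝ)) / ((m : ℝ) ^ (1 / α) * L m))
      atTop ζ (fun _ => P₁) P') {n : ℕ → ℕ} (hn : Tendsto n atTop atTop) :
    TendstoInDistribution (fun d ω => diagPart ξ d (n d) ω / stableNorming α L d (n d)) atTop ζ
      (fun _ => P) P' := by
  have hnd : Tendsto (fun d => n d * d) atTop atTop := hn.atTop_mul_atTop₀ tendsto_id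
  refine tendstoInDistribution_of_forall_identDistrib
    (tendstoInDistribution_comp_tendsto hattr hnd) fun d => ?_
  simpa only [Function.comp_def, Nat.cast_mul, diagPart, stableNorming] using
    (hξ.identDistrib_sum_sq hη d (n d)).comp
      (u := fun x => (x - (n d * d : ℕ)) / stableNorming α L d (n d)) (by fun_prop)

theorem IndependentCopies.tendstoInDistribution_offDiagPart (hξ : IndependentCopies ξ P ξ₀ P₀)
    (h0 : ∫ ω, ξ₀ ω ∂P₀ = 0) (h1 : ∫ ω, ξ₀ ω ^ 2 ∂P₀ = 1) {n : ℕ → ℕ}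
    (hn : Tendsto n atTop atTop) :
    TendstoInDistribution (fun d ω => offDiagPart ξ d (n d) ω / gaussianNorming d (n d)) atTop
      (id : ℝ → ℝ) (fun _ => P) (gaussianReal 0 1) := by
  have hcolumn : iIndepFun (fun i => ξ (i, 0)) P := hξ.indep.precomp (Prod.mk_left_injective 0)
  have hident (i : ℕ) := hξ.identDistrib (i, 0)
  have hmean (i : ℕ) : ∫ ω, ξ (i, 0) ω ∂P = 0 := (hident i).integral_eq.trans h0
  have hsq (i : ℕ) : ∫ ω, ξ (i, 0) ω ^ 2 ∂P = 1 :=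
    ((hident i).comp (u := (· ^ 2)) (by fun_prop)).integral_eq.trans h1
  have hL2 (i : ℕ) : MemLp (ξ (i, 0)) 2 P :=
    (memLp_two_iff_integrable_sq (hident i).aemeasurable_fst.aestronglyMeasurable).2
      (.of_integral_ne_zero ((hsq i).trans_ne one_ne_zero))
  have hlimVar : ∫ x, ((√2)⁻¹ * (x ^ 2 - 1)) ^ 2 ∂gaussianReal 0 1 = 1 := by
    simp only [mul_pow, inv_pow, integral_const_mul, Real.sq_sqrt zero_le_two]
    have hvar := integral_sq_sub_sq_gaussianReal 1
    simp only [NNReal.coe_one, one_pow, mul_one] at hvar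
    rw [hvar, inv_mul_cancel₀ two_ne_zero]
  have hclt := tendstoInDistribution_inv_sqrt_mul_sum_triangular (v := 1)
    (X := fun d j ω => (√2 * n d)⁻¹ * offDiagSum (Finset.range (n d)) fun i => ξ (i, j) ω)
    (P := fun _ => P)
    (fun d => (hξ.iIndepFun_offDiagSum_column (n d)).comp (fun _ x => (√2 * n d)⁻¹ * x)
      fun _ => by fun_prop)
    (fun d j => (hξ.identDistrib_offDiagSum_column (n d) j 0).comp (measurable_const_mul _))
    (fun d => (memLp_two_offDiagSum hcolumn hL2 _).const_mul _)
    (fun d => by rw [integral_const_mul, integral_offDiagSum hcolumn hL2 hmean, mul_zero])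
    (tendstoInDistribution_comp_tendsto (tendstoInDistribution_offDiagSum hcolumn
      (fun i => (hident i).trans (hident 0).symm) (hmean 0) (hsq 0)) hn)
    (by simpa using (memLp_sq_sub_gaussianReal 1).const_mul (√2)⁻¹)
    hlimVar
    ((tendsto_integral_sq_offDiagSum hcolumn hL2 hmean hsq).comp hn)
  convert! hclt using 3 with d ω
  rw [← Finset.mul_sum, ← mul_assoc, ← mul_inv, offDiagPart, gaussianNorming, div_eq_inv_mul,
    mul_comm √(d : ℝ)]

end Walk

theorem mainTheorem8_general
    {Ω₀ Ω₁ Ω Ω' : Type*} [MeasurableSpace Ω₀] [MeasurableSpace Ω₁] [MeasurableSpace Ω]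
    [MeasurableSpace Ω'] (P₀ : Measure Ω₀) (P₁ : Measure Ω₁) (P : Measure Ω) (P' : Measure Ω')
    [IsProbabilityMeasure P₁] [IsProbabilityMeasure P] [IsProbabilityMeasure P']
    (ξ₀ : Ω₀ → ℝ) (hmean : ∫ ω, ξ₀ ω ∂P₀ = 0) (hvar : ∫ ω, ξ₀ ω ^ 2 ∂P₀ = 1)
    (ξ : ℕ × ℕ → Ω → ℝ) (hξ : IndependentCopies ξ P ξ₀ P₀)
    (α : ℝ) (hα : 1 < α) (L : ℝ → ℝ) (hL : IsSlowlyVarying L) (ζ : Ω' → ℝ)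
    (η : ℕ → Ω₁ → ℝ) (hη : IndependentCopies η P₁ ξ₀ P₀)
    (hattr : TendstoInDistribution
      (fun (m : ℕ) ω =>
        ((∑ k ∈ Finset.range m, η k ω ^ 2) - (m : ℝ)) / ((m : ℝ) ^ (1 / α) * L (m : ℝ)))
      atTop ζ (fun _ => P₁) P')
    (n : ℕ → ℕ) (hn : Tendsto n atTop atTop) :
    ((∃ δ : ℝ, 0 < δ ∧
        ∀ᶠ d : ℕ in atTop, (d : ℝ) ^ ((2 - α) / (2 * α - 2) + δ) < (n d : ℝ)) →
      TendstoInDistribution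
        (fun (d : ℕ) ω => (‖walk ξ d (n d) ω‖ ^ 2 - (n d : ℝ)) / √(2 * (n d : ℝ) ^ 2 / (d : ℝ)))
        atTop (id : ℝ → ℝ) (fun _ => P) (gaussianReal 0 1)) ∧
    ((∃ δ : ℝ, 0 < δ ∧
        ∀ᶠ d : ℕ in atTop, (n d : ℝ) < (d : ℝ) ^ ((2 - α) / (2 * α - 2) - δ)) →
      TendstoInDistribution
        (fun (d : ℕ) ω => (‖walk ξ d (n d) ω‖ ^ 2 - (n d : ℝ)) /
          ((d : ℝ)⁻¹ * ((n d : ℝ) * (d : ℝ)) ^ (1 / α) * L ((n d : ℝ) * (d : ℝ))))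
        atTop ζ (fun _ => P) P') := by
  have hdiag := hξ.tendstoInDistribution_diagPart hη hattr hn
  have hoff := hξ.tendstoInDistribution_offDiagPart hmean hvar hn
  have hwalk := aemeasurable_norm_walk_sq_sub fun p => (hξ.identDistrib p).aemeasurable_fst
  refine ⟨fun ⟨δ, hδ, hnd⟩ => ?_, fun ⟨δ, hδ, hnd⟩ => ?_⟩
  · refine tendstoInDistribution_of_eventually_eq_add_smul hoff hdiag
      (tendsto_stableNorming_div_gaussianNorming_zero hα hL hn hδ hnd)
      (fun d => (hwalk d (n d)).div_const _) ?_
    filter_upwards [eventually_stableNorming_pos hL α hn, eventually_ne_atTop 0] with d hb hd ω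
    exact norm_walk_sq_sub_div_sqrt ξ hd ω hb.ne'
  · refine tendstoInDistribution_of_eventually_eq_add_smul hdiag hoff
      (tendsto_stableNorming_div_gaussianNorming_atTop hα hL hn hδ hnd).inv_tendsto_atTop
      (fun d => (hwalk d (n d)).div_const _) ?_
    filter_upwards [eventually_ne_atTop 0, hn.eventually_ne_atTop 0] with d hd hn0 ω
    exact norm_walk_sq_sub_div_stable ξ hd hn0 ω α L

theorem mainTheorem8
    {Ω₀ Ω₁ Ω Ω' : Type*} [MeasurableSpace Ω₀] [MeasurableSpace Ω₁] [MeasurableSpace Ω]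
    [MeasurableSpace Ω'] (P₀ : Measure Ω₀) (P₁ : Measure Ω₁) (P : Measure Ω) (P' : Measure Ω')
    [IsProbabilityMeasure P₀] [IsProbabilityMeasure P₁] [IsProbabilityMeasure P]
    [IsProbabilityMeasure P']
    -- the generic random variable `ξ`, with mean `0` and variance `1`
    (ξ₀ : Ω₀ → ℝ) (hmeas : AEMeasurable ξ₀ P₀)
    (hmean : ∫ ω, ξ₀ ω ∂P₀ = 0) (hvar : ∫ ω, ξ₀ ω ^ 2 ∂P₀ = 1)
    -- the array of independent copies of `ξ` that defines the random walks
    (ξ : ℕ × ℕ → Ω → ℝ) (hξ : IndependentCopies ξ P ξ₀ P₀)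
    -- the stable limit and the slowly varying function
    (α : ℝ) (hα : α ∈ Set.Ioo (1 : ℝ) 2) (L : ℝ → ℝ) (hL : IsSlowlyVarying L)
    (ζ : Ω' → ℝ) (hζ : AEMeasurable ζ P') (hstable : IsSpectrallyPositiveStable α (P'.map ζ))
    (hζint : Integrable ζ P') (hζmean : ∫ ω, ζ ω ∂P' = 0)
    -- `ξ²` is in the domain of attraction of the law of `ζ`
    (η : ℕ → Ω₁ → ℝ) (hη : IndependentCopies η P₁ ξ₀ P₀)
    (hattr : TendstoInDistribution
      (fun (m : ℕ) ω =>
        ((∑ k ∈ Finset.range m, η k ω ^ 2) - (m : ℝ)) / ((m : ℝ) ^ (1 / α) * L (m : ℝ)))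
      atTop ζ (fun _ => P₁) P')
    -- the number of steps
    (n : ℕ → ℕ) (hn : Tendsto n atTop atTop) :
    ((∃ δ : ℝ, 0 < δ ∧
        ∀ᶠ d : ℕ in atTop, (d : ℝ) ^ ((2 - α) / (2 * α - 2) + δ) < (n d : ℝ)) →
      TendstoInDistribution
        (fun (d : ℕ) ω => (‖walk ξ d (n d) ω‖ ^ 2 - (n d : ℝ)) / √(2 * (n d : ℝ) ^ 2 / (d : ℝ)))
        atTop (id : ℝ → ℝ) (fun _ => P) (gaussianReal 0 1)) ∧
    ((∃ δ : ℝ, 0 < δ ∧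
        ∀ᶠ d : ℕ in atTop, (n d : ℝ) < (d : ℝ) ^ ((2 - α) / (2 * α - 2) - δ)) →
      TendstoInDistribution
        (fun (d : ℕ) ω => (‖walk ξ d (n d) ω‖ ^ 2 - (n d : ℝ)) /
          ((d : ℝ)⁻¹ * ((n d : ℝ) * (d : ℝ)) ^ (1 / α) * L ((n d : ℝ) * (d : ℝ))))
        atTop ζ (fun _ => P) P') := by
  exact mainTheorem8_general P₀ P₁ P P' ξ₀ hmean hvar ξ hξ α hα.1 L hL ζ η hη hattr n hn
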